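/- Let $(V,E)$ be an infinite, locally finite, connected graph. Let each edge $xy\in E$ carry real numbers $R_{xy},L_{xy},D_{xy}\ge 0$ (resistance, inductance, inverse capacitance) with $R_{xy}+L_{xy}+D_{xy}>0$, and for $\lambda\in\mathbb C\setminus\{0\}$ let $z_{xy}^{(\lambda)}=R_{xy}+L_{xy}\lambda+D_{xy}/\lambda$ be its impedance. Let $\Lambda$ be the set of all $\lambda\in\mathbb{C}\setminus\{0\}$ with $z_{xy}^{(\lambda)}\ne0$ for all $xy\in E$; for $\lambda\in\Lambda$ put $\rho_{xy}=\rho_{xy}^{(\lambda)}=1/z_{xy}^{(\lambda)}$ if $xy\in E$ and $\rho_{xy}=0$ otherwise. Fix a vertex $a\in V$ and a (possibly empty) set $B\subset V$ with $a\notin B$. For $n\ge 1$ let $V_n=\{x\in V:\operatorname{dist}(a,x)\le n\}$, $\partial V_n=\{x\in V:\operatorname{dist}(a,x)=n\}$, where $\operatorname{dist}$ is the graph distance, and $B_n=(B\cap V_n)\cup\partial V_n$. For $\lambda\in\Lambda$ the partial effective admittance is $$\mathcal P_n(\lambda)=\sum_{x\in V_n}(1-v(x))\,\rho_{xa}^{(\lambda)}\in\mathbb{C},$$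 where $v:V_n\to\mathbb C$ is any solution of the Dirichlet problem $$\sum_{y\in V_n}(v(y)-v(x))\rho^{(\lambda)}_{xy}=0\ \text{ for } x\in V_n\setminus(B_n\cup\{a\}),\qquad v=0\ \text{ on } B_n,\qquad v(a)=1$$ (the value does not depend on the choice of $v$), and $\mathcal P_n(\lambda)=\infty$ if there is no solution. Then the following holds. (a) The sequence $\{\mathcal P_n(\lambda)\}_{n\ge1}$ converges locally uniformly in the domain $\{\operatorname{Re}\lambda>0\}$. (b) If $L_{xy}>0$ for all $xy\in E$ and $$S_D:=\sup_{xy\in E}\frac{D_{xy}}{L_{xy}}<\infty,\qquad S_R:=\sup_{xy\in E}\frac{R_{xy}}{L_{xy}}<\infty,$$ then $\{\mathcal P_n(\lambda)\}$ converges locally uniformly in $\Omega=\{\lambda\in\mathbb C:\operatorname{Im}\lambda\ne0,\ |\lambda|^2>S_D\}$. (c) If, in addition to the hypotheses of (b), $S_D^*:=\inf_{xy\in E}\frac{D_{xy}}{L_{xy}}>0$, then $\{\mathcal P_n(\lambda)\}$ converges locally uniformly in $\Omega^*=\{\lambda\in\mathbb C:\operatorname{Im}\lambda\ne0,\ |\lambda|^2<S_D^*\}$.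 In all cases the domain in question is contained in $\Lambda$, all $\mathcal P_n$ $(n\ge1)$ are finite there, and the limit $\mathcal P(\lambda)=\lim_{n\to\infty}\mathcal P_n(\lambda)$ is a holomorphic function in that domain. -/

import Mathlib

noncomputable section

/-! ### Finite networks, given by complex weights `ρ x y` on a finite vertex set
(`ρ x y = 0` when `x`, `y` are not joined by an edge), a source `a` and a ground `B`. -/

namespace FiniteNetwork

variable {W : Type*} [Fintype W]

/-- The physical Laplacian `Δ_ρ f (x) = ∑_y (f y - f x) ρ_{xy}`. -/
def laplacian (ρ : W → W → ℂ) (f : W → ℂ) (x : W) : ℂ :=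
  ∑ y, (f y - f x) * ρ x y

/-- `v` solves the Dirichlet problem with unit voltage at `a` and zero voltage on `B`. -/
structure IsVoltage (ρ : W → W → ℂ) (a : W) (B : Set W) (v : W → ℂ) : Prop where
  harmonic : ∀ x, x ∉ B → x ≠ a → laplacian ρ v x = 0
  ground : ∀ x ∈ B, v x = 0
  source : v a = 1

/-- The total current through `a`. -/
def current (ρ : W → W → ℂ) (a : W) (v : W → ℂ) : ℂ :=
  ∑ x, (1 - v x) * ρ x a

open Classical in
/-- The effective admittance, with values in `ℂ ∪ {∞}`: the total current through `a` of a solution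
of the Dirichlet problem, and `∞` if there is no solution. For symmetric `ρ` the value
does not depend on the solution. -/
def effectiveAdmittance (ρ : W → W → ℂ) (a : W) (B : Set W) : OnePoint ℂ :=
  if h : ∃ v : W → ℂ, IsVoltage ρ a B v then ((current ρ a h.choose : ℂ) : OnePoint ℂ)
  else OnePoint.infty

end FiniteNetwork

/-- An infinite, locally finite, connected graph with resistances `R`, inductances `L` and inverse
capacitances `D` on the edges, a source vertex `a` and a (possibly empty) ground set `B`.
The values of `R`, `L`, `D` off the edge set are irrelevant. -/
structure InfiniteNetwork (V : Type*) where
  graph : SimpleGraph V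
  infinite : Infinite V
  connected : graph.Connected
  locallyFinite : ∀ x, (graph.neighborSet x).Finite
  R : Sym2 V → ℝ
  L : Sym2 V → ℝ
  D : Sym2 V → ℝ
  R_nonneg : ∀ e ∈ graph.edgeSet, 0 ≤ R e
  L_nonneg : ∀ e ∈ graph.edgeSet, 0 ≤ L e
  D_nonneg : ∀ e ∈ graph.edgeSet, 0 ≤ D e
  sum_pos : ∀ e ∈ graph.edgeSet, 0 < R e + L e + D e
  a : V
  B : Set V
  a_notMem_B : a ∉ B

namespace InfiniteNetwork

variable {V : Type*} (N : InfiniteNetwork V)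

/-- The impedance `R + L λ + D / λ` of an edge. -/
def impedance (lam : ℂ) (e : Sym2 V) : ℂ :=
  (N.R e : ℂ) + (N.L e : ℂ) * lam + (N.D e : ℂ) / lam

open Classical in
/-- The admittance `ρ_{xy} = 1 / z_{xy}` for `x ∼ y`, extended by `0` to all other pairs. -/
def admittance (lam : ℂ) (x y : V) : ℂ :=
  if N.graph.Adj x y then 1 / N.impedance lam s(x, y) else 0

/-- The parameters `λ` for which all edge admittances are finite and non-zero. -/
def admissible : Set ℂ :=
  {lam | lam ≠ 0 ∧ ∀ e ∈ N.graph.edgeSet, N.impedance lam e ≠ 0}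

/-- The ball `V_n` around the source. -/
def ball (n : ℕ) : Set V := {x | N.graph.dist N.a x ≤ n}

/-- The sphere `∂V_n` around the source. -/
def sphere (n : ℕ) : Set V := {x | N.graph.dist N.a x = n}

theorem a_mem_ball (n : ℕ) : N.a ∈ N.ball n := by
  simp [ball]

theorem ball_finite (n : ℕ) : (N.ball n).Finite := by
  induction n with
  | zero =>
    refine (Set.finite_singleton N.a).subset fun x hx => ?_
    have h0 : N.graph.dist N.a x = 0 := Nat.le_zero.mp hx
    exact ((N.connected.dist_eq_zero_iff).mp h0).symm
  | succ n ih =>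
    refine (ih.union (ih.biUnion fun x _ => N.locallyFinite x)).subset fun x hx => ?_
    obtain ⟨p, hp⟩ := N.connected.exists_walk_length_eq_dist x N.a
    rw [SimpleGraph.dist_comm] at hp
    cases p with
    | nil => exact Or.inl (N.a_mem_ball n)
    | cons h q =>
      refine Or.inr (Set.mem_biUnion ?_ h.symm)
      have hq := SimpleGraph.dist_le q.reverse
      have hx' : N.graph.dist N.a x ≤ n + 1 := hx
      simp only [SimpleGraph.Walk.length_cons, SimpleGraph.Walk.length_reverse] at hp hq
      change N.graph.dist N.a _ ≤ n
      omega

instance ballFintype (n : ℕ) : Fintype (N.ball n) := (N.ball_finite n).fintype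

/-- The ground `B_n = (B ∩ V_n) ∪ ∂V_n` of the `n`-th partial network, as a subset of `V_n`. -/
def partialGround (n : ℕ) : Set (N.ball n) := {x | (x : V) ∈ N.B ∪ N.sphere n}

/-- The partial effective admittance `P_n(λ)`: the effective admittance of the finite network
`(V_n, ρ|_{V_n}, a, B_n)`. It is meaningful for `n ≥ 1`, since `a ∈ ∂V_0`. -/
def partialAdmittance (n : ℕ) (lam : ℂ) : OnePoint ℂ :=
  FiniteNetwork.effectiveAdmittance (fun x y : N.ball n => N.admittance lam x y)
    ⟨N.a, N.a_mem_ball n⟩ (N.partialGround n)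

/-- On `U` all the `P_n`, `n ≥ 1`, are defined and finite, and they converge locally uniformly
to `P`, which is holomorphic on `U`. -/
def ConvergesHolomorphicallyOn (P : ℂ → ℂ) (U : Set ℂ) : Prop :=
  U ⊆ N.admissible ∧
  (∃ p : ℕ → ℂ → ℂ,
    (∀ n, 1 ≤ n → ∀ lam ∈ U, N.partialAdmittance n lam = ((p n lam : ℂ) : OnePoint ℂ)) ∧
    TendstoLocallyUniformlyOn p P Filter.atTop U) ∧
  DifferentiableOn ℂ P U

/-- The set of the ratios `D_{xy} / L_{xy}` over the edges. -/
def ratiosDL : Set ℝ := (fun e => N.D e / N.L e) '' N.graph.edgeSet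

/-- The set of the ratios `R_{xy} / L_{xy}` over the edges. -/
def ratiosRL : Set ℝ := (fun e => N.R e / N.L e) '' N.graph.edgeSet

end InfiniteNetwork

end

/-! On `ℓ²` of the oriented edges, dividing each impedance by `R + L + D` gives a bounded diagonal
operator `Z(λ)`, even if the parameters are unbounded. Taking the real part of `⟨u, Z u⟩` when `Re λ
> 0`, and the imaginary part in the other two domains, shows `|⟨u, Z u⟩| ≥ c ‖u‖²`. Hence `A = Z⁻¹`
exists, is coercive and depends holomorphically on `λ`.

With gradients weighted by `(R + L + D)^(-1/2)`, the Dirichlet problem on the `n`-th ball becomes a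
Galerkin problem: find `g` in `f + K_n` with `A g ⟂ K_n`, where `f` is the gradient of the indicator
of `a` and `K_n` consists of the gradients of functions supported on the free vertices. Then `P_n =
⟨f, A g⟩ / 2` (`partialAdmittance_eq`).

The `K_n` increase, so Céa's argument gives pointwise convergence to the response on the closure of
their union (`tendsto_solution`). Coercivity makes the responses locally Lipschitz in `A`, with
constants independent of the subspace, which upgrades this to locally uniform convergence
(`tendstoLocallyUniformlyOn_response`). The limit is holomorphic because operator inversion is. -/

noncomputable section

/-! ### Coercive operators and their Galerkin approximations -/

namespace Galerkin

open Filter Topology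

variable {H : Type*} [NormedAddCommGroup H] [InnerProductSpace ℂ H]

/-- The operator `A` is coercive with constant `c`. -/
def Coercive (c : ℝ) (A : H →L[ℂ] H) : Prop :=
  ∀ u, c * ‖u‖ ^ 2 ≤ ‖inner ℂ u (A u)‖

/-- The Lax–Milgram theorem. -/
theorem Coercive.isUnit [CompleteSpace H] {c : ℝ} (hc : 0 < c) {A : H →L[ℂ] H}
    (hA : Coercive c A) : IsUnit A := by
  refine ContinuousLinearMap.isUnit_of_forall_le_norm_inner_map A (c := ⟨c, hc.le⟩) hc fun x => ?_
  rw [norm_inner_symm, mul_comm]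
  exact hA x

/-- Coercivity is stable under small perturbations. -/
theorem Coercive.perturb {c d : ℝ} {A A' : H →L[ℂ] H} (hA : Coercive c A)
    (hd : ‖A' - A‖ ≤ d) : Coercive (c - d) A' := by
  intro u
  have h1 : inner ℂ u (A u) = inner ℂ u (A' u) - inner ℂ u ((A' - A) u) := by
    rw [← inner_sub_right]; simp
  have h2 : ‖inner ℂ u ((A' - A) u)‖ ≤ d * ‖u‖ ^ 2 := by
    calc _ ≤ ‖u‖ * ‖(A' - A) u‖ := norm_inner_le_norm _ _
      _ ≤ ‖u‖ * (d * ‖u‖) := by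
        gcongr
        exact ((A' - A).le_opNorm u).trans (by gcongr)
      _ = _ := by ring
  have h3 := hA u
  rw [h1] at h3
  have h4 := norm_sub_le (inner ℂ u (A' u)) (inner ℂ u ((A' - A) u))
  linarith

/-- The inverse of a coercive operator is coercive. -/
theorem Coercive.inverse [CompleteSpace H] {c : ℝ} (hc : 0 < c) {A : H →L[ℂ] H}
    (hA : Coercive c A) : ∃ c' > 0, Coercive c' (Ring.inverse A) := by
  -- With `w = A⁻¹ u`, the form of `A⁻¹` at `u` has the modulus of the form of `A` at `w`, and `‖u‖
  -- ≤ (‖A‖ + 1) ‖w‖`. The `+ 1` keeps the denominator positive.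
  refine ⟨c / (‖A‖ + 1) ^ 2, by positivity, fun u => ?_⟩
  set w := Ring.inverse A u
  have hw : A w = u := by
    have := Ring.mul_inverse_cancel A (hA.isUnit hc)
    exact congrArg (fun T : H →L[ℂ] H => T u) this
  have h1 : ‖u‖ ≤ (‖A‖ + 1) * ‖w‖ := by
    rw [← hw]
    exact (A.le_opNorm w).trans (by gcongr; linarith)
  have h2 := hA w
  rw [hw, norm_inner_symm] at h2
  refine le_trans ?_ h2
  rw [div_mul_eq_mul_div, div_le_iff₀ (by positivity), mul_assoc]
  gcongr
  calc ‖u‖ ^ 2 ≤ ((‖A‖ + 1) * ‖w‖) ^ 2 := by gcongr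
    _ = _ := by ring

theorem Coercive.norm_le {c b : ℝ} {A : H →L[ℂ] H} (hA : Coercive c A)
    {u : H} (hb : 0 ≤ b) (h : ‖inner ℂ u (A u)‖ ≤ ‖u‖ * b) : c * ‖u‖ ≤ b := by
  rcases (norm_nonneg u).eq_or_lt with h0 | h0
  · rw [← h0]; simpa using hb
  · have := (hA u).trans h
    have h2 : ‖u‖ * (c * ‖u‖) ≤ ‖u‖ * b := by linarith [sq ‖u‖, mul_comm c (‖u‖ ^ 2)]
    exact le_of_mul_le_mul_left h2 h0

/-! ### The Galerkin problem on a fixed subspace -/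

section Solution

variable (K : Submodule ℂ H) [K.HasOrthogonalProjection]

/-- The compression of `A` to the subspace `K`. -/
def compress (A : H →L[ℂ] H) : K →L[ℂ] K :=
  K.orthogonalProjectionOnto ∘L A ∘L K.subtypeL

/-- The element `g ∈ f + K` with `A g ⟂ K`. -/
def solution (A : H →L[ℂ] H) (f : H) : H :=
  f - (Ring.inverse (compress K A) (K.orthogonalProjectionOnto (A f)) : K)

variable {K}

theorem inner_compress (A : H →L[ℂ] H) (u v : K) :
    inner ℂ u (compress K A v) = inner ℂ (u : H) (A v) := by
  simp [compress]

theorem Coercive.isUnit_compress [CompleteSpace K] {c : ℝ} (hc : 0 < c) {A : H →L[ℂ] H}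
    (hA : Coercive c A) : IsUnit (compress K A) :=
  Coercive.isUnit hc fun u => by
    rw [inner_compress]
    exact hA u

variable (K) in
theorem solution_sub_mem (A : H →L[ℂ] H) (f : H) : solution K A f - f ∈ K := by
  simp [solution]

theorem inner_apply_solution [CompleteSpace K] {c : ℝ} (hc : 0 < c) {A : H →L[ℂ] H}
    (hA : Coercive c A) (f : H) {h : H} (hh : h ∈ K) : inner ℂ h (A (solution K A f)) = 0 := by
  set w := Ring.inverse (compress K A) (K.orthogonalProjectionOnto (A f)) with hw
  have h1 : compress K A w = K.orthogonalProjectionOnto (A f) :=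
    congrArg (fun T : K →L[ℂ] K => T (K.orthogonalProjectionOnto (A f)))
      (Ring.mul_inverse_cancel _ (hA.isUnit_compress hc))
  have h2 := inner_compress A ⟨h, hh⟩ w
  rw [h1, Submodule.inner_orthogonalProjectionOnto_eq_of_mem_left] at h2
  rw [solution, ← hw, map_sub, inner_sub_right]
  exact sub_eq_zero.mpr h2

/-- The difference of two solutions lies in `K`, so the form of `A` vanishes at it and coercivity
kills it. -/
theorem eq_solution [CompleteSpace K] {c : ℝ} (hc : 0 < c) {A : H →L[ℂ] H} (hA : Coercive c A)
    {f g : H} (hg : g - f ∈ K) (h : ∀ k ∈ K, inner ℂ k (A g) = 0) : g = solution K A f := by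
  have hK : g - solution K A f ∈ K := by
    have := K.sub_mem hg (solution_sub_mem K A f)
    rwa [sub_sub_sub_cancel_right] at this
  have h1 : inner ℂ (g - solution K A f) (A (g - solution K A f)) = 0 := by
    rw [map_sub, inner_sub_right, h _ hK, inner_apply_solution hc hA f hK, sub_zero]
  have h2 := hA.norm_le (u := g - solution K A f) le_rfl (by rw [h1]; simp)
  have h3 : ‖g - solution K A f‖ ≤ 0 := nonpos_of_mul_nonpos_right h2 hc
  exact sub_eq_zero.mp (norm_le_zero_iff.mp h3)

/-- Testing the equation with `g - f ∈ K` bounds the correction by a constant free of `K`. -/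
theorem norm_solution_le [CompleteSpace K] {c : ℝ} (hc : 0 < c) {A : H →L[ℂ] H}
    (hA : Coercive c A) (f : H) : ‖solution K A f‖ ≤ ‖f‖ + ‖A‖ * ‖f‖ / c := by
  have h1 : inner ℂ (solution K A f - f) (A (solution K A f - f)) =
      - inner ℂ (solution K A f - f) (A f) := by
    rw [map_sub, inner_sub_right, inner_apply_solution hc hA f (solution_sub_mem K A f), zero_sub]
  have h2 := hA.norm_le (u := solution K A f - f) (b := ‖A‖ * ‖f‖) (by positivity) (by
    rw [h1, norm_neg]
    exact (norm_inner_le_norm _ _).trans (by gcongr; exact A.le_opNorm f))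
  have h3 : ‖solution K A f - f‖ ≤ ‖A‖ * ‖f‖ / c := by
    rw [le_div_iff₀ hc]; linarith
  calc ‖solution K A f‖ = ‖f + (solution K A f - f)‖ := by congr 1; abel
    _ ≤ _ := (norm_add_le _ _).trans (by gcongr)

/-- The dependence of the solution on the operator, uniformly in the subspace. -/
theorem norm_solution_sub_solution_le [CompleteSpace K] {c c' : ℝ} (hc : 0 < c) (hc' : 0 < c')
    {A A' : H →L[ℂ] H} (hA : Coercive c A) (hA' : Coercive c' A') (f : H) :
    c' * ‖solution K A' f - solution K A f‖ ≤ ‖A' - A‖ * ‖solution K A f‖ := by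
  have hK : solution K A' f - solution K A f ∈ K := by
    have := K.sub_mem (solution_sub_mem K A' f) (solution_sub_mem K A f)
    rwa [sub_sub_sub_cancel_right] at this
  refine hA'.norm_le (by positivity) ?_
  have h1 : inner ℂ (solution K A' f - solution K A f) (A' (solution K A' f - solution K A f)) =
      - inner ℂ (solution K A' f - solution K A f) ((A' - A) (solution K A f)) := by
    rw [map_sub, inner_sub_right, inner_apply_solution hc' hA' f hK,
      sub_apply, inner_sub_right, inner_apply_solution hc hA f hK]
    simp
  rw [h1, norm_neg]
  exact (norm_inner_le_norm _ _).trans (by gcongr; exact (A' - A).le_opNorm _)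

end Solution

/-! ### Convergence and holomorphy along increasing subspaces -/

section Approximation

variable {Kn : ℕ → Submodule ℂ H} [∀ n, (Kn n).HasOrthogonalProjection] [∀ n, CompleteSpace (Kn n)]
  {K : Submodule ℂ H} [K.HasOrthogonalProjection] [CompleteSpace K]

/-- Céa's argument: the error is at most `‖A‖ / c` times the distance from `g - f` to any element of
`K_n`, and the union of the `K_n` is dense in `K`. -/
theorem tendsto_solution (hmono : Monotone Kn) (hK : K = (⨆ n, Kn n).topologicalClosure)
    {c : ℝ} (hc : 0 < c) {A : H →L[ℂ] H} (hA : Coercive c A) (f : H) :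
    Tendsto (fun n => solution (Kn n) A f) atTop (𝓝 (solution K A f)) := by
  have hle (n : ℕ) : Kn n ≤ K := hK ▸ (le_iSup Kn n).trans (Submodule.le_topologicalClosure _)
  rw [Metric.tendsto_atTop]
  intro ε hε
  have hmem : solution K A f - f ∈ closure ((⨆ n, Kn n : Submodule ℂ H) : Set H) := by
    rw [← Submodule.topologicalClosure_coe, ← hK]
    exact solution_sub_mem K A f
  obtain ⟨h, hh, hd⟩ := Metric.mem_closure_iff.mp hmem (ε * c / (‖A‖ + 1)) (by positivity)
  obtain ⟨m, hm⟩ := (Submodule.mem_iSup_of_directed Kn hmono.directed_le).mp hh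
  refine ⟨m, fun n hn => ?_⟩
  set g := solution K A f
  set gn := solution (Kn n) A f
  set δ := gn - g with hδ
  have horth : ∀ k ∈ Kn n, inner ℂ k (A δ) = 0 := fun k hk => by
    rw [hδ, map_sub, inner_sub_right, inner_apply_solution hc hA f hk,
      inner_apply_solution hc hA f (hle n hk), sub_zero]
  -- Galerkin orthogonality: `gn - f - h` lies in `Kn n`, so it contributes nothing.
  have hsplit : inner ℂ δ (A δ) = inner ℂ (h - (g - f)) (A δ) := by
    have : δ = (gn - f - h) + (h - (g - f)) := by rw [hδ]; abel
    conv_lhs => rw [this]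
    rw [inner_add_left, ← this,
      horth _ ((Kn n).sub_mem (solution_sub_mem _ A f) (hmono hn hm)), zero_add]
  have hb := hA.norm_le (u := δ) (b := ‖A‖ * ‖h - (g - f)‖) (by positivity) (by
    rw [hsplit]
    calc _ ≤ ‖h - (g - f)‖ * (‖A‖ * ‖δ‖) :=
          (norm_inner_le_norm _ _).trans (by gcongr; exact A.le_opNorm _)
      _ = _ := by ring)
  rw [dist_eq_norm, ← norm_neg, neg_sub, lt_div_iff₀ (by positivity)] at hd
  rw [dist_eq_norm]
  have h0 := norm_nonneg (h - (g - f))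
  have : c * ‖δ‖ < c * ε := by nlinarith
  exact lt_of_mul_lt_mul_left this hc.le

theorem differentiableAt_solution {A : ℂ → H →L[ℂ] H} {z : ℂ} (hdiff : DifferentiableAt ℂ A z)
    {c : ℝ} (hc : 0 < c) (hA : Coercive c (A z)) (f : H) :
    DifferentiableAt ℂ (fun w => solution K (A w) f) z := by
  have h1 : DifferentiableAt ℂ (fun w => compress K (A w)) z :=
    (differentiableAt_const _).clm_comp (hdiff.clm_comp (differentiableAt_const _))
  have h2 : DifferentiableAt ℂ (fun w => Ring.inverse (compress K (A w))) z :=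
    DifferentiableAt.inverse (R := K →L[ℂ] K) (𝕜 := ℂ) (z := z)
      (h := fun w => compress K (A w)) h1 (hA.isUnit_compress hc)
  have h3 : DifferentiableAt ℂ (fun w => K.orthogonalProjectionOnto (A w f)) z :=
    (differentiableAt_const (K.orthogonalProjectionOnto)).clm_apply
      (hdiff.clm_apply (differentiableAt_const f))
  exact (differentiableAt_const f).sub
    ((differentiableAt_const K.subtypeL).clm_apply (h2.clm_apply h3))

/-- The quantity `⟨f, A g⟩` for the solution `g` of the problem on `K`. -/
def response (K : Submodule ℂ H) [K.HasOrthogonalProjection] (A : H →L[ℂ] H) (f : H) : ℂ :=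
  inner ℂ f (A (solution K A f))

theorem differentiableAt_response {A : ℂ → H →L[ℂ] H} {z : ℂ} (hdiff : DifferentiableAt ℂ A z)
    {c : ℝ} (hc : 0 < c) (hA : Coercive c (A z)) (f : H) :
    DifferentiableAt ℂ (fun w => response K (A w) f) z :=
  (differentiableAt_const (innerSL ℂ f)).clm_apply
    (hdiff.clm_apply (differentiableAt_solution hdiff hc hA f))

/-- The response is locally Lipschitz in the operator, uniformly in the subspace. -/
theorem norm_response_sub_response_le {c d : ℝ} (hc : 0 < c) {A A' : H →L[ℂ] H}
    (hA : Coercive c A) (hd : ‖A' - A‖ ≤ d) (hdc : d ≤ c / 2) (f : H) :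
    ‖response K A' f - response K A f‖ ≤
      ‖f‖ * (1 + (‖A‖ + d) * (2 / c)) * (‖f‖ + ‖A‖ * ‖f‖ / c) * d := by
  have hc2 : 0 < c / 2 := by positivity
  -- A perturbation of norm at most `c / 2` costs at most half of the coercivity constant.
  have hA' : Coercive (c / 2) A' := fun u => by
    refine le_trans ?_ (hA.perturb hd u)
    gcongr
    linarith
  have hd0 : 0 ≤ d := (norm_nonneg _).trans hd
  have h1 := norm_solution_sub_solution_le (K := K) hc hc2 hA hA' f
  have h2 := norm_solution_le (K := K) hc hA f
  set g := solution K A f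
  set g' := solution K A' f
  set M := ‖f‖ + ‖A‖ * ‖f‖ / c
  have h3 : ‖g' - g‖ ≤ 2 / c * (d * M) := by
    have : c / 2 * ‖g' - g‖ ≤ d * M := h1.trans (by gcongr)
    rw [div_mul_eq_mul_div, le_div_iff₀ hc]
    linarith
  have h4 : ‖A'‖ ≤ ‖A‖ + d := by
    have := norm_add_le A (A' - A)
    rw [add_sub_cancel] at this
    linarith
  have h5 : response K A' f - response K A f = inner ℂ f (A' (g' - g) + (A' - A) g) := by
    rw [response, response, ← inner_sub_right]
    congr 1
    simp [g, g']
  rw [h5]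
  calc _ ≤ ‖f‖ * ‖A' (g' - g) + (A' - A) g‖ := norm_inner_le_norm _ _
    _ ≤ ‖f‖ * ((‖A‖ + d) * (2 / c * (d * M)) + d * M) := by
      gcongr
      refine (norm_add_le _ _).trans (add_le_add ?_ ?_)
      · exact (A'.le_opNorm _).trans (by gcongr)
      · exact ((A' - A).le_opNorm _).trans (by gcongr)
    _ = _ := by ring

/-- An `ε / 3` argument: one neighbourhood of `z` controls the variation of all responses at once,
so convergence at `z` alone suffices. -/
theorem tendstoLocallyUniformlyOn_response (hmono : Monotone Kn)
    (hK : K = (⨆ n, Kn n).topologicalClosure) {A : ℂ → H →L[ℂ] H} {U : Set ℂ}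
    (hcont : ∀ z ∈ U, ContinuousAt A z) (hA : ∀ z ∈ U, ∃ c > 0, Coercive c (A z)) (f : H) :
    TendstoLocallyUniformlyOn (fun n z => response (Kn n) (A z) f)
      (fun z => response K (A z) f) atTop U := by
  rw [Metric.tendstoLocallyUniformlyOn_iff]
  intro ε hε z hz
  obtain ⟨c, hc, hAc⟩ := hA z hz
  set C : ℝ → ℝ := fun d => ‖f‖ * (1 + (‖A z‖ + d) * (2 / c)) * (‖f‖ + ‖A z‖ * ‖f‖ / c) * d
  have hC : Tendsto C (𝓝 0) (𝓝 0) := by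
    have : Continuous C := by fun_prop
    simpa [C] using this.tendsto 0
  have hd : Tendsto (fun w => ‖A w - A z‖) (𝓝 z) (𝓝 0) := by
    have := ((hcont z hz).sub (continuousAt_const (y := A z))).norm
    simpa [ContinuousAt] using this
  have hnear : ∀ᶠ w in 𝓝 z, ‖A w - A z‖ < c / 2 ∧ C ‖A w - A z‖ < ε / 3 :=
    (hd.eventually (gt_mem_nhds (by positivity))).and
      ((hC.comp hd).eventually (gt_mem_nhds (by positivity)))
  have hpt : Tendsto (fun n => response (Kn n) (A z) f) atTop (𝓝 (response K (A z) f)) :=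
    tendsto_const_nhds.inner (((A z).continuous.tendsto _).comp (tendsto_solution hmono hK hc hAc f))
  refine ⟨_, mem_nhdsWithin_of_mem_nhds hnear, ?_⟩
  filter_upwards [Metric.tendsto_nhds.mp hpt (ε / 3) (by positivity)] with n hn w hw
  have h1 := norm_response_sub_response_le (K := K) hc hAc le_rfl hw.1.le f
  have h2 := norm_response_sub_response_le (K := Kn n) hc hAc le_rfl hw.1.le f
  rw [← dist_eq_norm] at h1 h2
  have h3 := dist_triangle4 (response K (A w) f) (response K (A z) f)
    (response (Kn n) (A z) f) (response (Kn n) (A w) f)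
  rw [dist_comm] at hn h2
  have := hw.2
  simp only [C] at this
  linarith

end Approximation

end Galerkin

end

noncomputable section

/-! ### Diagonal operators on `ℓ²` -/

namespace DiagonalOperator

variable {ι : Type*}

/-- Multiplication by a real function `m` with `|m| ≤ 1`. -/
def diag (m : ι → ℝ) (hm : ∀ i, |m i| ≤ 1) : lp (fun _ : ι => ℂ) 2 →L[ℂ] lp (fun _ : ι => ℂ) 2 :=
  lp.mapCLM 2 (fun i => (m i : ℂ) • ContinuousLinearMap.id ℂ ℂ) zero_le_one fun i => by
    rw [norm_smul, ContinuousLinearMap.norm_id, mul_one, Complex.norm_real]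
    exact hm i

variable {m m' : ι → ℝ} {hm : ∀ i, |m i| ≤ 1}
  (u : lp (fun _ : ι => ℂ) 2)

theorem diag_apply (i : ι) : diag m hm u i = m i * u i := rfl

variable (m) in
/-- The quadratic form `∑ m i ‖u i‖ ^ 2`. -/
def quad : ℝ := ∑' i, m i * ‖u i‖ ^ 2

theorem hasSum_complex_quad :
    HasSum (fun i => ((m i * ‖u i‖ ^ 2 : ℝ) : ℂ)) (inner ℂ u (diag m hm u)) := by
  refine (lp.hasSum_inner u (diag m hm u)).congr_fun fun i => ?_
  rw [diag_apply, RCLike.inner_apply, mul_assoc, Complex.mul_conj, Complex.normSq_eq_norm_sq]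
  push_cast
  ring

theorem hasSum_quad (hm : ∀ i, |m i| ≤ 1) : HasSum (fun i => m i * ‖u i‖ ^ 2) (quad m u) :=
  (Complex.hasSum_re (hasSum_complex_quad (hm := hm) u)).summable.hasSum

theorem inner_diag : inner ℂ u (diag m hm u) = (quad m u : ℂ) :=
  (hasSum_complex_quad u).unique (Complex.hasSum_ofReal.mpr (hasSum_quad u hm))

theorem quad_le_mul_quad (hm : ∀ i, |m i| ≤ 1) (hm' : ∀ i, |m' i| ≤ 1) {C : ℝ}
    (h : ∀ i, m i ≤ C * m' i) : quad m u ≤ C * quad m' u :=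
  hasSum_le (fun i => by
    rw [← mul_assoc]
    exact mul_le_mul_of_nonneg_right (h i) (by positivity))
    (hasSum_quad u hm) ((hasSum_quad u hm').mul_left C)

theorem quad_nonneg (h : ∀ i, 0 ≤ m i) : 0 ≤ quad m u :=
  tsum_nonneg fun i => mul_nonneg (h i) (by positivity)

theorem quad_add_quad_add_quad {m'' : ι → ℝ} (hm : ∀ i, |m i| ≤ 1) (hm' : ∀ i, |m' i| ≤ 1)
    (hm'' : ∀ i, |m'' i| ≤ 1) (h : ∀ i, m i + m' i + m'' i = 1) :
    quad m u + quad m' u + quad m'' u = ‖u‖ ^ 2 := by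
  have h1 : inner ℂ u (diag m hm u + diag m' hm' u + diag m'' hm'' u) = inner ℂ u u := by
    congr 1
    ext i
    simp only [lp.coeFn_add, Pi.add_apply, diag_apply, ← add_mul]
    rw [← Complex.ofReal_add, ← Complex.ofReal_add, h i]
    simp
  rw [inner_add_right, inner_add_right, inner_diag, inner_diag, inner_diag,
    inner_self_eq_norm_sq_to_K] at h1
  exact Complex.ofReal_injective (by push_cast; exact h1)

end DiagonalOperator

end

noncomputable section

namespace InfiniteNetwork

open DiagonalOperator Galerkin Filter Topology

variable {V : Type*} (N : InfiniteNetwork V)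

/-! ### The impedance operator -/

/-- The Hilbert space of square summable functions on the oriented edges. -/
abbrev EdgeSpace : Type _ := lp (fun _ : N.graph.Dart => ℂ) 2

/-- The total `R + L + D` of the parameters of an oriented edge. -/
def total (d : N.graph.Dart) : ℝ := N.R d.edge + N.L d.edge + N.D d.edge

theorem total_pos (d : N.graph.Dart) : 0 < N.total d := N.sum_pos _ d.edge_mem

theorem total_symm (d : N.graph.Dart) : N.total d.symm = N.total d := by
  simp [total]

/-- The normalized resistance of an oriented edge. -/
def normR (d : N.graph.Dart) : ℝ := N.R d.edge / N.total d

/-- The normalized inductance of an oriented edge. -/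
def normL (d : N.graph.Dart) : ℝ := N.L d.edge / N.total d

/-- The normalized inverse capacitance of an oriented edge. -/
def normD (d : N.graph.Dart) : ℝ := N.D d.edge / N.total d

theorem normR_nonneg (d : N.graph.Dart) : 0 ≤ N.normR d :=
  div_nonneg (N.R_nonneg _ d.edge_mem) (N.total_pos d).le

theorem normL_nonneg (d : N.graph.Dart) : 0 ≤ N.normL d :=
  div_nonneg (N.L_nonneg _ d.edge_mem) (N.total_pos d).le

theorem normD_nonneg (d : N.graph.Dart) : 0 ≤ N.normD d :=
  div_nonneg (N.D_nonneg _ d.edge_mem) (N.total_pos d).le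

theorem norm_add_norm_add_norm (d : N.graph.Dart) : N.normR d + N.normL d + N.normD d = 1 := by
  rw [normR, normL, normD, ← add_div, ← add_div]
  exact div_self (N.total_pos d).ne'

theorem abs_normR_le (d : N.graph.Dart) : |N.normR d| ≤ 1 := by
  rw [abs_of_nonneg (N.normR_nonneg d)]
  linarith [N.norm_add_norm_add_norm d, N.normL_nonneg d, N.normD_nonneg d]

theorem abs_normL_le (d : N.graph.Dart) : |N.normL d| ≤ 1 := by
  rw [abs_of_nonneg (N.normL_nonneg d)]
  linarith [N.norm_add_norm_add_norm d, N.normR_nonneg d, N.normD_nonneg d]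

theorem abs_normD_le (d : N.graph.Dart) : |N.normD d| ≤ 1 := by
  rw [abs_of_nonneg (N.normD_nonneg d)]
  linarith [N.norm_add_norm_add_norm d, N.normR_nonneg d, N.normL_nonneg d]

/-- Multiplication by the normalized impedances. -/
def impedanceOp (lam : ℂ) : N.EdgeSpace →L[ℂ] N.EdgeSpace :=
  diag N.normR N.abs_normR_le + lam • diag N.normL N.abs_normL_le +
    lam⁻¹ • diag N.normD N.abs_normD_le

/-- Multiplication by the inverses of the normalized impedances. -/
def admittanceOp (lam : ℂ) : N.EdgeSpace →L[ℂ] N.EdgeSpace := Ring.inverse (N.impedanceOp lam)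

theorem impedanceOp_apply (lam : ℂ) (u : N.EdgeSpace) (d : N.graph.Dart) :
    N.impedanceOp lam u d = N.impedance lam d.edge / N.total d * u d := by
  have h : N.impedanceOp lam u d =
      N.normR d * u d + lam * (N.normL d * u d) + lam⁻¹ * (N.normD d * u d) := rfl
  rw [h, impedance, normR, normL, normD]
  push_cast
  ring

theorem inner_impedanceOp (lam : ℂ) (u : N.EdgeSpace) :
    inner ℂ u (N.impedanceOp lam u) =
      (quad N.normR u : ℂ) + lam * quad N.normL u + lam⁻¹ * quad N.normD u := by
  simp [impedanceOp, inner_diag]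

/-- The parameters for which the impedance operator is coercive. -/
def coerciveSet : Set ℂ := {lam | lam ≠ 0 ∧ ∃ c > 0, Coercive c (N.impedanceOp lam)}

theorem differentiableAt_impedanceOp {lam : ℂ} (h : lam ≠ 0) :
    DifferentiableAt ℂ N.impedanceOp lam :=
  ((differentiableAt_const _).add (differentiableAt_id.smul_const _)).add
    ((differentiableAt_inv h).smul_const _)

variable {N} {lam : ℂ}

theorem differentiableAt_admittanceOp (h : lam ∈ N.coerciveSet) :
    DifferentiableAt ℂ N.admittanceOp lam := by
  obtain ⟨h0, c, hc, hA⟩ := h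
  exact DifferentiableAt.inverse (R := N.EdgeSpace →L[ℂ] N.EdgeSpace) (𝕜 := ℂ) (z := lam)
    (h := N.impedanceOp)
    (N.differentiableAt_impedanceOp h0) (hA.isUnit hc)

theorem coercive_admittanceOp (h : lam ∈ N.coerciveSet) :
    ∃ c > 0, Coercive c (N.admittanceOp lam) := by
  obtain ⟨-, c, hc, hA⟩ := h
  exact hA.inverse hc

/-- A vanishing impedance would make a unit vector of `ℓ²` a null vector of the operator. -/
theorem impedance_ne_zero (h : lam ∈ N.coerciveSet) (d : N.graph.Dart) :
    N.impedance lam d.edge ≠ 0 := by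
  classical
  obtain ⟨-, c, hc, hA⟩ := h
  intro h0
  have h1 : N.impedanceOp lam (lp.single 2 d 1) = 0 := by
    ext d'
    rw [impedanceOp_apply]
    by_cases hd : d' = d
    · subst hd; simp [h0]
    · simp [hd]
  have h2 := hA (lp.single 2 d 1)
  rw [h1, inner_zero_right, lp.norm_single (by norm_num)] at h2
  norm_num at h2
  linarith

theorem coerciveSet_subset_admissible : N.coerciveSet ⊆ N.admissible := by
  refine fun lam h => ⟨h.1, fun e he => ?_⟩
  induction e with
  | _ x y => exact impedance_ne_zero h ⟨(x, y), he⟩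

theorem admittanceOp_apply (h : lam ∈ N.coerciveSet) (u : N.EdgeSpace) (d : N.graph.Dart) :
    N.admittanceOp lam u d = N.total d / N.impedance lam d.edge * u d := by
  have h0 := impedance_ne_zero h d
  obtain ⟨-, c, hc, hA⟩ := h
  have h1 : N.impedanceOp lam (N.admittanceOp lam u) = u :=
    congrArg (fun T : N.EdgeSpace →L[ℂ] N.EdgeSpace => T u)
      (Ring.mul_inverse_cancel _ (hA.isUnit hc))
  have h2 := N.impedanceOp_apply lam (N.admittanceOp lam u) d
  rw [h1] at h2
  have h3 : (N.total d : ℂ) ≠ 0 := by exact_mod_cast (N.total_pos d).ne'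
  rw [h2]
  field_simp

/-! ### Coercivity in the three domains -/

/-- The real part of the form has coefficients `1`, `Re λ` and `Re λ / |λ|²`, all positive; `c` is
their minimum. -/
theorem mem_coerciveSet_of_re_pos (h : 0 < lam.re) : lam ∈ N.coerciveSet := by
  have h0 : lam ≠ 0 := by rintro rfl; simp at h
  have hn : 0 < Complex.normSq lam := Complex.normSq_pos.mpr h0
  set c := min 1 (min lam.re (lam.re / Complex.normSq lam))
  refine ⟨h0, c, by positivity, fun u => ?_⟩
  refine le_trans ?_ (Complex.re_le_norm _)
  rw [inner_impedanceOp, ← quad_add_quad_add_quad u N.abs_normR_le N.abs_normL_le N.abs_normD_le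
    N.norm_add_norm_add_norm]
  simp only [Complex.add_re, Complex.ofReal_re, Complex.re_mul_ofReal, Complex.inv_re]
  have h1 : c ≤ 1 := min_le_left _ _
  have h2 : c ≤ lam.re := (min_le_right _ _).trans (min_le_left _ _)
  have h3 : c ≤ lam.re / Complex.normSq lam := (min_le_right _ _).trans (min_le_right _ _)
  nlinarith [mul_le_mul_of_nonneg_right h1 (quad_nonneg u N.normR_nonneg),
    mul_le_mul_of_nonneg_right h2 (quad_nonneg u N.normL_nonneg),
    mul_le_mul_of_nonneg_right h3 (quad_nonneg u N.normD_nonneg)]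

/-- Resistances drop out, while inductances and capacitances enter with opposite signs; coercivity
needs one of them to dominate. -/
theorem inner_impedanceOp_im (lam : ℂ) (u : N.EdgeSpace) :
    (inner ℂ u (N.impedanceOp lam u)).im =
      lam.im * (quad N.normL u - quad N.normD u / ‖lam‖ ^ 2) := by
  rw [inner_impedanceOp, ← Complex.normSq_eq_norm_sq]
  simp only [Complex.add_im, Complex.ofReal_im, Complex.im_mul_ofReal, Complex.inv_im]
  ring

theorem abs_im_mul_le_norm_inner (lam : ℂ) (u : N.EdgeSpace) :
    |lam.im| * |quad N.normL u - quad N.normD u / ‖lam‖ ^ 2| ≤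
      ‖inner ℂ u (N.impedanceOp lam u)‖ := by
  rw [← abs_mul, ← inner_impedanceOp_im]
  exact Complex.abs_im_le_norm _

theorem normD_le (hL : ∀ e ∈ N.graph.edgeSet, 0 < N.L e) (hD : BddAbove N.ratiosDL)
    (d : N.graph.Dart) : N.normD d ≤ sSup N.ratiosDL * N.normL d := by
  have h := le_csSup hD ⟨d.edge, d.edge_mem, rfl⟩
  rw [div_le_iff₀ (hL _ d.edge_mem)] at h
  rw [normD, normL, ← mul_div_assoc]
  exact div_le_div_of_nonneg_right h (N.total_pos d).le

theorem normR_le (hL : ∀ e ∈ N.graph.edgeSet, 0 < N.L e) (hR : BddAbove N.ratiosRL)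
    (d : N.graph.Dart) : N.normR d ≤ sSup N.ratiosRL * N.normL d := by
  have h := le_csSup hR ⟨d.edge, d.edge_mem, rfl⟩
  rw [div_le_iff₀ (hL _ d.edge_mem)] at h
  rw [normR, normL, ← mul_div_assoc]
  exact div_le_div_of_nonneg_right h (N.total_pos d).le

theorem ratiosDL_nonneg {r : ℝ} (h : r ∈ N.ratiosDL) : 0 ≤ r := by
  obtain ⟨e, he, rfl⟩ := h
  exact div_nonneg (N.D_nonneg e he) (N.L_nonneg e he)

theorem ratiosRL_nonneg {r : ℝ} (h : r ∈ N.ratiosRL) : 0 ≤ r := by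
  obtain ⟨e, he, rfl⟩ := h
  exact div_nonneg (N.R_nonneg e he) (N.L_nonneg e he)

theorem mul_normL_le (hL : ∀ e ∈ N.graph.edgeSet, 0 < N.L e) (d : N.graph.Dart) :
    sInf N.ratiosDL * N.normL d ≤ N.normD d := by
  have h := csInf_le ⟨0, fun r hr => ratiosDL_nonneg hr⟩
    (show N.D d.edge / N.L d.edge ∈ N.ratiosDL from ⟨d.edge, d.edge_mem, rfl⟩)
  rw [le_div_iff₀ (hL _ d.edge_mem)] at h
  rw [normD, normL, ← mul_div_assoc]
  exact div_le_div_of_nonneg_right h (N.total_pos d).le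

theorem mem_coerciveSet_of_sSup_lt (hL : ∀ e ∈ N.graph.edgeSet, 0 < N.L e)
    (hD : BddAbove N.ratiosDL) (hR : BddAbove N.ratiosRL) (him : lam.im ≠ 0)
    (h : sSup N.ratiosDL < ‖lam‖ ^ 2) : lam ∈ N.coerciveSet := by
  have h0 : lam ≠ 0 := by rintro rfl; simp at him
  have hn : 0 < ‖lam‖ ^ 2 := by positivity
  have hSD : 0 ≤ sSup N.ratiosDL := Real.sSup_nonneg fun r hr => ratiosDL_nonneg hr
  have hSR : 0 ≤ sSup N.ratiosRL := Real.sSup_nonneg fun r hr => ratiosRL_nonneg hr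
  set SD := sSup N.ratiosDL
  set SR := sSup N.ratiosRL
  have hgap : 0 < 1 - SD / ‖lam‖ ^ 2 := by rw [sub_pos, div_lt_one hn]; exact h
  -- The inductive part dominates: it controls `‖u‖²` up to the factor `SR + 1 + SD`, and the
  -- imaginary part retains the fraction `1 - SD / |λ|²` of it.
  refine ⟨h0, |lam.im| * (1 - SD / ‖lam‖ ^ 2) / (SR + 1 + SD), by positivity, fun u => ?_⟩
  refine le_trans ?_ (abs_im_mul_le_norm_inner lam u)
  have h1 : quad N.normD u ≤ SD * quad N.normL u :=
    quad_le_mul_quad u N.abs_normD_le N.abs_normL_le (normD_le hL hD)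
  have h2 : quad N.normR u ≤ SR * quad N.normL u :=
    quad_le_mul_quad u N.abs_normR_le N.abs_normL_le (normR_le hL hR)
  have h3 := quad_add_quad_add_quad u N.abs_normR_le N.abs_normL_le N.abs_normD_le
    N.norm_add_norm_add_norm
  have h4 : ‖u‖ ^ 2 ≤ (SR + 1 + SD) * quad N.normL u := by linarith
  calc _ ≤ |lam.im| * (1 - SD / ‖lam‖ ^ 2) / (SR + 1 + SD) *
        ((SR + 1 + SD) * quad N.normL u) := by gcongr
    _ = |lam.im| * (quad N.normL u - SD * quad N.normL u / ‖lam‖ ^ 2) := by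
      field_simp
    _ ≤ |lam.im| * (quad N.normL u - quad N.normD u / ‖lam‖ ^ 2) := by gcongr
    _ ≤ _ := by gcongr; exact le_abs_self _

theorem mem_coerciveSet_of_lt_sInf (hL : ∀ e ∈ N.graph.edgeSet, 0 < N.L e)
    (hR : BddAbove N.ratiosRL) (hpos : 0 < sInf N.ratiosDL) (him : lam.im ≠ 0)
    (h : ‖lam‖ ^ 2 < sInf N.ratiosDL) : lam ∈ N.coerciveSet := by
  have h0 : lam ≠ 0 := by rintro rfl; simp at him
  have hn : 0 < ‖lam‖ ^ 2 := by positivity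
  have hSR : 0 ≤ sSup N.ratiosRL := Real.sSup_nonneg fun r hr => ratiosRL_nonneg hr
  set I := sInf N.ratiosDL
  set SR := sSup N.ratiosRL
  have hgap : 0 < 1 / ‖lam‖ ^ 2 - 1 / I := by
    rw [sub_pos]; exact one_div_lt_one_div_of_lt hn h
  -- Now the capacitive part dominates: inductances are at most `1 / I` times it and resistances at
  -- most `SR / I` times it.
  refine ⟨h0, |lam.im| * (1 / ‖lam‖ ^ 2 - 1 / I) / (SR / I + 1 / I + 1), by positivity,
    fun u => ?_⟩
  refine le_trans ?_ (abs_im_mul_le_norm_inner lam u)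
  have h1 : quad N.normL u ≤ 1 / I * quad N.normD u :=
    quad_le_mul_quad u N.abs_normL_le N.abs_normD_le fun d => by
      rw [div_mul_eq_mul_div, one_mul, le_div_iff₀ hpos, mul_comm]
      exact mul_normL_le hL d
  have h2 : quad N.normR u ≤ SR * quad N.normL u :=
    quad_le_mul_quad u N.abs_normR_le N.abs_normL_le (normR_le hL hR)
  have h3 := quad_add_quad_add_quad u N.abs_normR_le N.abs_normL_le N.abs_normD_le
    N.norm_add_norm_add_norm
  have h4 : ‖u‖ ^ 2 ≤ (SR / I + 1 / I + 1) * quad N.normD u := by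
    have : SR * quad N.normL u ≤ SR * (1 / I * quad N.normD u) := by gcongr
    calc _ ≤ SR * (1 / I * quad N.normD u) + 1 / I * quad N.normD u + quad N.normD u := by linarith
      _ = _ := by ring
  calc _ ≤ |lam.im| * (1 / ‖lam‖ ^ 2 - 1 / I) / (SR / I + 1 / I + 1) *
        ((SR / I + 1 / I + 1) * quad N.normD u) := by gcongr
    _ = |lam.im| * (1 / ‖lam‖ ^ 2 - 1 / I) * quad N.normD u := by
      rw [← mul_assoc, div_mul_cancel₀]
      positivity
    _ = |lam.im| * (quad N.normD u / ‖lam‖ ^ 2 - 1 / I * quad N.normD u) := by ring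
    _ ≤ |lam.im| * (quad N.normD u / ‖lam‖ ^ 2 - quad N.normL u) := by gcongr
    _ ≤ _ := by
      gcongr
      rw [← neg_sub]
      exact neg_le_abs _

end InfiniteNetwork

end

noncomputable section

namespace InfiniteNetwork

open DiagonalOperator Galerkin Filter Topology

variable {V : Type*} (N : InfiniteNetwork V)

/-! ### Gradients of finitely supported functions -/

theorem finite_dartsAt (x : V) : {d : N.graph.Dart | d.fst = x}.Finite := by
  refine Set.Finite.of_finite_image (f := fun d : N.graph.Dart => d.snd)
    ((N.locallyFinite x).subset ?_) ?_
  · rintro _ ⟨d, rfl, rfl⟩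
    exact d.adj
  · intro d hd d' hd' h
    exact SimpleGraph.Dart.ext _ _ (Prod.ext (hd.trans hd'.symm) h)

/-- The oriented edges that start at `x`. -/
def dartsAt (x : V) : Finset N.graph.Dart := (N.finite_dartsAt x).toFinset

variable {N} in
theorem mem_dartsAt {x : V} {d : N.graph.Dart} : d ∈ N.dartsAt x ↔ d.fst = x := by
  simp [dartsAt]

/-- The square root of the weight `1 / (R + L + D)`. -/
def weight (d : N.graph.Dart) : ℝ := (√(N.total d))⁻¹

theorem weight_symm (d : N.graph.Dart) : N.weight d.symm = N.weight d := by
  rw [weight, weight, total_symm]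

/-- The two gradient weights cancel the normalization of the impedance, so the true admittances
reappear in the energy form. -/
theorem weight_mul_total_mul_weight (d : N.graph.Dart) :
    (N.weight d : ℂ) * N.total d * N.weight d = 1 := by
  have h := N.total_pos d
  have : N.weight d * N.total d * N.weight d = 1 := by
    rw [weight]
    nth_rewrite 2 [← Real.mul_self_sqrt h.le]
    have := Real.sqrt_pos.mpr h
    field_simp
  exact_mod_cast this

open Classical in
/-- The weighted gradient of the indicator function of `x`. -/
def gradSingle (x : V) : N.EdgeSpace :=
  ∑ d ∈ N.dartsAt x, (lp.single 2 d.symm (N.weight d : ℂ) - lp.single 2 d (N.weight d : ℂ))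

theorem inner_gradSingle (x : V) (u : N.EdgeSpace) :
    inner ℂ (N.gradSingle x) u = ∑ d ∈ N.dartsAt x, (N.weight d : ℂ) * (u d.symm - u d) := by
  classical
  rw [gradSingle, sum_inner]
  refine Finset.sum_congr rfl fun d _ => ?_
  rw [inner_sub_left, lp.inner_single_left, lp.inner_single_left]
  simp only [RCLike.inner_apply, Complex.conj_ofReal]
  ring

open Classical in
theorem gradSingle_apply (x : V) (d : N.graph.Dart) :
    N.gradSingle x d =
      N.weight d * ((if d.snd = x then 1 else 0) - (if d.fst = x then 1 else 0)) := by
  have h1 (d' : N.graph.Dart) : lp.single (E := fun _ => ℂ) 2 d'.symm (N.weight d' : ℂ) d =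
      if d.symm = d' then (N.weight d : ℂ) else 0 := by
    rw [lp.single_apply]
    split_ifs with h
    · subst h; simp [weight_symm]
    · refine Pi.single_eq_of_ne ?_ _
      rintro rfl
      simp at h
  have h2 (d' : N.graph.Dart) : lp.single (E := fun _ => ℂ) 2 d' (N.weight d' : ℂ) d =
      if d = d' then (N.weight d : ℂ) else 0 := by
    rw [lp.single_apply]
    split_ifs with h
    · subst h; simp
    · exact Pi.single_eq_of_ne h _
  rw [gradSingle, lp.coeFn_sum, Finset.sum_apply]
  simp only [lp.coeFn_sub, Pi.sub_apply, h1, h2]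
  rw [Finset.sum_sub_distrib, Finset.sum_ite_eq, Finset.sum_ite_eq]
  simp only [mem_dartsAt, mul_sub, mul_ite, mul_one, mul_zero]
  rfl

/-- The weighted gradient of a finitely supported function. -/
def grad : (V →₀ ℂ) →ₗ[ℂ] N.EdgeSpace := Finsupp.linearCombination ℂ N.gradSingle

theorem grad_single (x : V) : N.grad (Finsupp.single x 1) = N.gradSingle x := by
  simp [grad]

theorem grad_apply (φ : V →₀ ℂ) (d : N.graph.Dart) :
    N.grad φ d = N.weight d * (φ d.snd - φ d.fst) := by
  classical
  induction φ using Finsupp.induction_linear with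
  | zero => simp
  | add f g hf hg =>
    rw [map_add, lp.coeFn_add, Pi.add_apply, hf, hg, Finsupp.add_apply, Finsupp.add_apply]
    ring
  | single x c =>
    rw [grad, Finsupp.linearCombination_single, lp.coeFn_smul, Pi.smul_apply, gradSingle_apply,
      Finsupp.single_apply, Finsupp.single_apply, smul_eq_mul]
    simp only [eq_comm (a := x)]
    split_ifs <;> ring

variable {N} {lam : ℂ}

/-- A discrete Green formula; the factor `2` arises because each edge carries two orientations. -/
theorem inner_gradSingle_admittanceOp_grad (h : lam ∈ N.coerciveSet) (x : V) (φ : V →₀ ℂ) :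
    inner ℂ (N.gradSingle x) (N.admittanceOp lam (N.grad φ)) =
      2 * ∑ d ∈ N.dartsAt x, (φ x - φ d.snd) * N.admittance lam x d.snd := by
  rw [inner_gradSingle, Finset.mul_sum]
  refine Finset.sum_congr rfl fun d hd => ?_
  obtain rfl := mem_dartsAt.mp hd
  have hz : N.admittance lam d.fst d.snd = 1 / N.impedance lam d.edge := by
    rw [admittance, if_pos d.adj]
    rfl
  rw [admittanceOp_apply h, admittanceOp_apply h, grad_apply, grad_apply, total_symm, weight_symm,
    SimpleGraph.Dart.edge_symm, hz]
  change (N.weight d : ℂ) * (N.total d / N.impedance lam d.edge * (N.weight d * (φ d.fst - φ d.snd))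
    - N.total d / N.impedance lam d.edge * (N.weight d * (φ d.snd - φ d.fst))) = _
  linear_combination (2 * (φ d.fst - φ d.snd) / N.impedance lam d.edge) *
    N.weight_mul_total_mul_weight d

theorem admittance_symm (lam : ℂ) (x y : V) : N.admittance lam x y = N.admittance lam y x := by
  classical
  rw [admittance, admittance, Sym2.eq_swap]
  exact if_congr (SimpleGraph.adj_comm _ _ _) rfl rfl

theorem mem_ball_of_adj {n : ℕ} {x y : V} (hx : N.graph.dist N.a x < n) (h : N.graph.Adj x y) :
    y ∈ N.ball n := by
  have h1 := N.connected.dist_triangle (u := N.a) (v := x) (w := y)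
  have h2 : N.graph.dist x y = 1 := SimpleGraph.dist_eq_one_iff_adj.mpr h
  change N.graph.dist N.a y ≤ n
  omega

/-- A weighted sum over the ball as a sum over the edges at an interior vertex. -/
theorem sum_ball_eq_sum_dartsAt {n : ℕ} {x : V} (hx : N.graph.dist N.a x < n) (F : V → ℂ) :
    ∑ y : N.ball n, F y * N.admittance lam x y =
      ∑ d ∈ N.dartsAt x, F d.snd * N.admittance lam x d.snd := by
  rw [← Finset.sum_subtype (N.ball_finite n).toFinset (fun y => Set.Finite.mem_toFinset _)
    (fun y => F y * N.admittance lam x y)]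
  symm
  refine Finset.sum_of_injOn (fun d => d.snd) ?_ ?_ ?_ fun _ _ => rfl
  · intro d hd d' hd' h
    exact SimpleGraph.Dart.ext _ _
      (Prod.ext ((mem_dartsAt.mp hd).trans (mem_dartsAt.mp hd').symm) h)
  · intro d hd
    obtain rfl := mem_dartsAt.mp hd
    simpa using mem_ball_of_adj hx d.adj
  · intro y _ hy
    rw [admittance, if_neg, mul_zero]
    exact fun hadj => hy ⟨⟨(x, y), hadj⟩, mem_dartsAt.mpr rfl, rfl⟩

/-! ### Voltages in the partial networks -/

variable (N) in
/-- The vertices of the `n`-th partial network at which the voltage is not prescribed. -/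
def interior (n : ℕ) : Set V := {x | N.graph.dist N.a x < n ∧ x ≠ N.a ∧ x ∉ N.B}

variable (N) in
/-- The gradients of the functions supported in the interior of the `n`-th partial network. -/
def testSpace (n : ℕ) : Submodule ℂ N.EdgeSpace :=
  Submodule.span ℂ (N.gradSingle '' N.interior n)

theorem testSpace_mono : Monotone N.testSpace := fun _ _ h =>
  Submodule.span_mono (Set.image_mono fun _ hx => ⟨hx.1.trans_le h, hx.2⟩)

instance finiteDimensional_testSpace (n : ℕ) : FiniteDimensional ℂ (N.testSpace n) :=
  FiniteDimensional.span_of_finite ℂ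
    (((N.ball_finite n).subset fun _ hx => le_of_lt hx.1).image _)

theorem mem_testSpace {n : ℕ} {u : N.EdgeSpace} :
    u ∈ N.testSpace n ↔ ∃ φ ∈ Finsupp.supported ℂ ℂ (N.interior n), N.grad φ = u :=
  Finsupp.mem_span_image_iff_linearCombination ℂ

theorem laplacian_eq {n : ℕ} (h : lam ∈ N.coerciveSet) (φ : V →₀ ℂ) {x : N.ball n}
    (hx : N.graph.dist N.a x < n) :
    FiniteNetwork.laplacian (fun x y : N.ball n => N.admittance lam x y) (fun x => φ x) x =
      -(1 / 2) * inner ℂ (N.gradSingle x) (N.admittanceOp lam (N.grad φ)) := by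
  rw [FiniteNetwork.laplacian, sum_ball_eq_sum_dartsAt hx (fun y => φ y - φ x),
    inner_gradSingle_admittanceOp_grad h, ← mul_assoc, Finset.mul_sum]
  refine Finset.sum_congr rfl fun d _ => ?_
  ring

theorem current_eq {n : ℕ} (hn : 1 ≤ n) (h : lam ∈ N.coerciveSet) (φ : V →₀ ℂ)
    (ha : φ N.a = 1) :
    FiniteNetwork.current (fun x y : N.ball n => N.admittance lam x y) ⟨N.a, N.a_mem_ball n⟩
      (fun x => φ x) =
      1 / 2 * inner ℂ (N.gradSingle N.a) (N.admittanceOp lam (N.grad φ)) := by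
  have hd : N.graph.dist N.a N.a < n := by rw [SimpleGraph.dist_self]; exact hn
  simp only [FiniteNetwork.current, admittance_symm lam _ N.a]
  rw [sum_ball_eq_sum_dartsAt hd (fun y => 1 - φ y), inner_gradSingle_admittanceOp_grad h, ha]
  ring

theorem mem_interior_of_notMem {n : ℕ} {x : N.ball n} (hx : x ∉ N.partialGround n)
    (hxa : (x : V) ≠ N.a) : (x : V) ∈ N.interior n := by
  have h1 : N.graph.dist N.a x ≤ n := x.2
  simp only [partialGround, sphere, Set.mem_ofPred_eq, Set.mem_union, not_or] at hx
  exact ⟨lt_of_le_of_ne h1 hx.2, hxa, hx.1⟩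

theorem exists_isVoltage {n : ℕ} (hn : 1 ≤ n) (h : lam ∈ N.coerciveSet) :
    ∃ v, FiniteNetwork.IsVoltage (fun x y : N.ball n => N.admittance lam x y)
      ⟨N.a, N.a_mem_ball n⟩ (N.partialGround n) v := by
  obtain ⟨c, hc, hA⟩ := coercive_admittanceOp h
  obtain ⟨φ, hφ, heq⟩ := mem_testSpace.mp
    (solution_sub_mem (N.testSpace n) (N.admittanceOp lam) (N.gradSingle N.a))
  -- The Galerkin solution is itself a gradient, and its potential is the required voltage.
  have hsol : N.grad (Finsupp.single N.a 1 + φ) =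
      solution (N.testSpace n) (N.admittanceOp lam) (N.gradSingle N.a) := by
    rw [map_add, grad_single, heq, add_sub_cancel]
  have hzero : ∀ x ∉ N.interior n, φ x = 0 := (Finsupp.mem_supported' ℂ φ).mp hφ
  refine ⟨fun x => (Finsupp.single N.a (1 : ℂ) + φ : V →₀ ℂ) x, ?_, ?_, ?_⟩
  · intro x hx hxa
    have hmem := mem_interior_of_notMem hx fun h => hxa (Subtype.ext h)
    have hgrad : N.gradSingle x ∈ N.testSpace n := Submodule.subset_span ⟨_, hmem, rfl⟩
    rw [laplacian_eq h _ hmem.1, hsol, inner_apply_solution hc hA _ hgrad, mul_zero]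
  · intro x hx
    have hxa : N.a ≠ x := by
      rintro hax
      rcases hx with hx | hx
      · exact N.a_notMem_B (hax ▸ hx)
      · rw [sphere, Set.mem_ofPred_eq, ← hax, SimpleGraph.dist_self] at hx
        -- Here `1 ≤ n` is needed: `a` must not lie on the sphere.
        omega
    rw [Finsupp.add_apply, Finsupp.single_eq_of_ne hxa.symm, hzero, zero_add]
    rintro ⟨h1, -, h2⟩
    rcases hx with hx | hx
    · exact h2 hx
    · exact h1.ne hx
  · have : φ N.a = 0 := hzero _ fun h => h.2.1 rfl
    simp [this]

/-- Every voltage, extended by zero, has the unique Galerkin solution as its gradient, so the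
current does not depend on the solution chosen. -/
theorem current_of_isVoltage {n : ℕ} (hn : 1 ≤ n) (h : lam ∈ N.coerciveSet) {v : N.ball n → ℂ}
    (hv : FiniteNetwork.IsVoltage (fun x y : N.ball n => N.admittance lam x y)
      ⟨N.a, N.a_mem_ball n⟩ (N.partialGround n) v) :
    FiniteNetwork.current (fun x y : N.ball n => N.admittance lam x y) ⟨N.a, N.a_mem_ball n⟩ v =
      1 / 2 * response (N.testSpace n) (N.admittanceOp lam) (N.gradSingle N.a) := by
  obtain ⟨c, hc, hA⟩ := coercive_admittanceOp h
  set φ : V →₀ ℂ := (Finsupp.equivFunOnFinite.symm v).embDomain (Function.Embedding.subtype _)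
    with hφ
  have hφv : (fun x : N.ball n => φ x) = v := funext fun x =>
    Finsupp.embDomain_apply_self (Function.Embedding.subtype _) _ x
  have hφ0 : ∀ x ∉ N.ball n, φ x = 0 := fun x hx =>
    Finsupp.embDomain_of_notMem_range _ _ _ (by simpa using hx)
  have ha : φ N.a = 1 := (congrFun hφv ⟨N.a, N.a_mem_ball n⟩).trans hv.source
  have hmem : N.grad φ - N.gradSingle N.a ∈ N.testSpace n := by
    refine mem_testSpace.mpr ⟨φ - Finsupp.single N.a 1, ?_, by rw [map_sub, grad_single]⟩
    refine (Finsupp.mem_supported' ℂ _).mpr fun x hx => ?_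
    rw [Finsupp.sub_apply]
    by_cases hxa : x = N.a
    · simp [hxa, ha]
    rw [Finsupp.single_eq_of_ne hxa, sub_zero]
    by_cases hxb : x ∈ N.ball n
    · by_contra hne
      refine hx (mem_interior_of_notMem (x := ⟨x, hxb⟩) (fun hg => hne ?_) hxa)
      exact (congrFun hφv ⟨x, hxb⟩).trans (hv.ground _ hg)
    · exact hφ0 x hxb
  -- Harmonicity at the free vertices is orthogonality to the generators of the test space.
  have horth : ∀ k ∈ N.testSpace n, inner ℂ k (N.admittanceOp lam (N.grad φ)) = 0 := by
    intro k hk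
    induction hk using Submodule.span_induction with
    | mem k hk =>
      obtain ⟨x, hx, rfl⟩ := hk
      have hxb : x ∈ N.ball n := le_of_lt hx.1
      have h1 := hv.harmonic ⟨x, hxb⟩ (fun hg => hg.elim hx.2.2 hx.1.ne)
        fun he => hx.2.1 (congrArg Subtype.val he)
      rw [← hφv, laplacian_eq h φ hx.1] at h1
      simpa using h1
    | zero => simp
    | add k k' _ _ hk hk' => rw [inner_add_left, hk, hk', add_zero]
    | smul c k _ hk => rw [inner_smul_left, hk, mul_zero]
  rw [← hφv, current_eq hn h φ ha, response, ← eq_solution hc hA hmem horth]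

theorem partialAdmittance_eq {n : ℕ} (hn : 1 ≤ n) (h : lam ∈ N.coerciveSet) :
    N.partialAdmittance n lam =
      ((1 / 2 * response (N.testSpace n) (N.admittanceOp lam) (N.gradSingle N.a) : ℂ) :
        OnePoint ℂ) := by
  have hex := exists_isVoltage hn h
  rw [partialAdmittance, FiniteNetwork.effectiveAdmittance, dif_pos hex,
    current_of_isVoltage hn h hex.choose_spec]

/-! ### The limit -/

variable (N) in
/-- The gradients of the finite energy functions with zero boundary values. -/
def limitSpace : Submodule ℂ N.EdgeSpace := (⨆ n, N.testSpace n).topologicalClosure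

instance completeSpace_limitSpace : CompleteSpace N.limitSpace :=
  (Submodule.isClosed_topologicalClosure _).completeSpace_coe

variable (N) in
/-- The effective admittance of the infinite network. -/
def limitAdmittance (lam : ℂ) : ℂ :=
  1 / 2 * response N.limitSpace (N.admittanceOp lam) (N.gradSingle N.a)

theorem convergesHolomorphicallyOn {U : Set ℂ} (hU : U ⊆ N.coerciveSet) :
    N.ConvergesHolomorphicallyOn N.limitAdmittance U := by
  refine ⟨hU.trans coerciveSet_subset_admissible,
    ⟨fun n lam => 1 / 2 * response (N.testSpace n) (N.admittanceOp lam) (N.gradSingle N.a),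
      fun n hn lam hlam => partialAdmittance_eq hn (hU hlam), ?_⟩, fun lam hlam => ?_⟩
  · have h := tendstoLocallyUniformlyOn_response testSpace_mono (K := N.limitSpace) rfl
      (fun z hz => (differentiableAt_admittanceOp (hU hz)).continuousAt)
      (fun z hz => coercive_admittanceOp (hU hz)) (N.gradSingle N.a)
    exact (uniformContinuous_const_smul (1 / 2 : ℂ)).comp_tendstoLocallyUniformlyOn h
  · obtain ⟨c, hc, hA⟩ := coercive_admittanceOp (hU hlam)
    exact ((differentiableAt_response (differentiableAt_admittanceOp (hU hlam)) hc hA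
      (N.gradSingle N.a)).const_mul (1 / 2)).differentiableWithinAt

end InfiniteNetwork

end

/-- One `P` serves all three domains, since neither the limit space nor the formula for the response
depends on the domain. -/
theorem mainTheorem1 {V : Type*} (N : InfiniteNetwork V) :
    ∃ P : ℂ → ℂ,
      N.ConvergesHolomorphicallyOn P {lam : ℂ | 0 < lam.re} ∧
      ((∀ e ∈ N.graph.edgeSet, 0 < N.L e) → BddAbove N.ratiosDL → BddAbove N.ratiosRL →
        N.ConvergesHolomorphicallyOn P {lam : ℂ | lam.im ≠ 0 ∧ sSup N.ratiosDL < ‖lam‖ ^ 2} ∧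
        (0 < sInf N.ratiosDL →
          N.ConvergesHolomorphicallyOn P
            {lam : ℂ | lam.im ≠ 0 ∧ ‖lam‖ ^ 2 < sInf N.ratiosDL})) :=
  ⟨N.limitAdmittance,
    InfiniteNetwork.convergesHolomorphicallyOn fun _ h =>
      InfiniteNetwork.mem_coerciveSet_of_re_pos h,
    fun hL hD hR =>
      ⟨InfiniteNetwork.convergesHolomorphicallyOn fun _ h =>
        InfiniteNetwork.mem_coerciveSet_of_sSup_lt hL hD hR h.1 h.2,
      fun hpos => InfiniteNetwork.convergesHolomorphicallyOn fun _ h =>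
        InfiniteNetwork.mem_coerciveSet_of_lt_sInf hL hR hpos h.1 h.2⟩⟩
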